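/- For an $n\times n$ real matrix $X=[x_{ij}]$ let $X^{\pi}$ be its rotation by 180 degrees, whose $(i,j)$ entry is $x_{n+1-i,\,n+1-j}$; $X$ is centrosymmetric if $X^{\pi}=X$. Let $\Omega_n^{\pi}$ be the polytope of centrosymmetric doubly stochastic $n\times n$ matrices. For $K,L\subseteq\{1,\dots,n\}$ let $X[K,L]$ be the submatrix with rows in $K$ and columns in $L$ (in increasing order), and let $\overline K,\overline L$ denote complements. If $n=2m-1$ is odd and $|K|=|L|$, then $X[K,L]$ is a centro-submatrix of $X$ if $m\in K\cap L$ and both $K$ and $L$ are invariant under $i\mapsto n+1-i$; it is isolated if $X[K,\overline L]$ and $X[\overline K,L]$ are zero matrices. An $r\times r$ permutation matrix $P=[p_{ij}]$ is anti-centrosymmetric if $p_{ij}=1$ implies $p_{r+1-i,\,r+1-j}=0$. In that case $P+P^{\pi}$ is called cyclic if its bipartite multigraph (one vertex for each row and each column, and as many edges between row $i$ and column $j$ as the $(i,j)$ entry says) is a single cycle of length $2r$; that is, if its rows and columns can be permuted so that row $k$ has its two 1's in columns $k$ and $k+1$ (modulo $r$). **Theorem.** Let $n=2m-1\ge 3$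 be odd. The set of extreme points of $\Omega_n^{\pi}$ is the set of $n\times n$ matrices $A$ for which there is a permutation matrix $Q=[q_{ij}]$ such that $A=\frac12(Q+Q^{\pi})$ and one of the following holds: (a) $q_{mm}=1$ and $Q$ is centrosymmetric (thus $Q=Q^{\pi}$ and $A$ is a centrosymmetric permutation matrix); or (b) $q_{mm}=0$, and there are an odd integer $r$, an $r\times r$ anti-centrosymmetric permutation matrix $P$ such that $P+P^{\pi}$ is cyclic, and an isolated centro-submatrix $A[K,L]$ of $A$ with $|K|=|L|=r$ and $A[K,L]=\frac12(P+P^{\pi})$, such that the complementary submatrix $A[\overline K,\overline L]$ is a (possibly empty) centrosymmetric permutation matrix (thus $Q[\overline K,\overline L]=Q[\overline K,\overline L]^{\pi}$). -/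

import Mathlib

namespace Centrosym

/-- The `180`-degree rotation `X^π`, with `(i, j)` entry `x_{n+1-i, n+1-j}`. -/
def rot {n : ℕ} (X : Matrix (Fin n) (Fin n) ℝ) : Matrix (Fin n) (Fin n) ℝ :=
  Matrix.of fun i j => X i.rev j.rev

/-- `X` is centrosymmetric: `X^π = X`. -/
def IsCentrosymmetric {n : ℕ} (X : Matrix (Fin n) (Fin n) ℝ) : Prop :=
  rot X = X

/-- `X` is a permutation matrix. -/
def IsPermutationMatrix {n : ℕ} (X : Matrix (Fin n) (Fin n) ℝ) : Prop :=
  ∃ σ : Equiv.Perm (Fin n), X = σ.permMatrix ℝ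

/-- The polytope `Ω_n^π` of centrosymmetric doubly stochastic `n × n` matrices. -/
def Omega (n : ℕ) : Set (Matrix (Fin n) (Fin n) ℝ) :=
  {X | X ∈ doublyStochastic ℝ (Fin n) ∧ IsCentrosymmetric X}

/-- The central index of `{1, …, n}` for odd `n = 2 m - 1`: the index `m`, which is `m - 1 = n / 2`
in the numbering from `0` that `Fin n` uses. -/
def centre {n : ℕ} (hn : Odd n) : Fin n :=
  ⟨n / 2, Nat.div_lt_self hn.pos one_lt_two⟩

/-- The `r × r` submatrix `X[K, L]`, rows in `K` and columns in `L` in their natural order. -/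
def sub {n r : ℕ} (X : Matrix (Fin n) (Fin n) ℝ) (K L : Finset (Fin n))
    (hK : K.card = r) (hL : L.card = r) : Matrix (Fin r) (Fin r) ℝ :=
  X.submatrix (K.orderEmbOfFin hK) (L.orderEmbOfFin hL)

theorem card_compl_eq {n r : ℕ} {K : Finset (Fin n)} (hK : K.card = r) :
    Kᶜ.card = n - r := by
  rw [Finset.card_compl, Fintype.card_fin, hK]

/-- The complementary submatrix `X[Kᶜ, Lᶜ]`. -/
def complSub {n r : ℕ} (X : Matrix (Fin n) (Fin n) ℝ) (K L : Finset (Fin n))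
    (hK : K.card = r) (hL : L.card = r) : Matrix (Fin (n - r)) (Fin (n - r)) ℝ :=
  sub X Kᶜ Lᶜ (card_compl_eq hK) (card_compl_eq hL)

/-- The index sets `K`, `L` (of equal size) define a centro-submatrix: both contain the central
index and both are invariant under `i ↦ n + 1 - i`. -/
def IsCentroPair {n : ℕ} (hn : Odd n) (K L : Finset (Fin n)) : Prop :=
  centre hn ∈ K ∧ centre hn ∈ L ∧ K.image Fin.rev = K ∧ L.image Fin.rev = L

/-- `X[K, L]` is isolated: `X[K, Lᶜ]` and `X[Kᶜ, L]` are zero matrices. -/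
def IsIsolated {n : ℕ} (X : Matrix (Fin n) (Fin n) ℝ) (K L : Finset (Fin n)) : Prop :=
  (∀ i ∈ K, ∀ j ∉ L, X i j = 0) ∧ (∀ i ∉ K, ∀ j ∈ L, X i j = 0)

/-- `P` is an anti-centrosymmetric permutation matrix. -/
def IsAntiCentrosymmetricPerm {r : ℕ} (P : Matrix (Fin r) (Fin r) ℝ) : Prop :=
  IsPermutationMatrix P ∧ ∀ i j, P i j = 1 → P i.rev j.rev = 0

/-- `X` is cyclic: the bipartite multigraph of the `r × r` matrix `X` (one vertex for each row, one
for each column, `x_{ij}` edges joining row `i` to column `j`) is a cycle of length `2 r`. That is,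
all rows and all columns can be listed as `u_0, …, u_{r-1}` and `v_0, …, v_{r-1}` so that the edges,
with multiplicity, are those of the closed walk `v_0 u_0 v_1 u_1 v_2 … v_{r-1} u_{r-1} v_0`. -/
def IsCyclic {r : ℕ} (X : Matrix (Fin r) (Fin r) ℝ) : Prop :=
  ∃ u v : Equiv.Perm (Fin r), ∀ k l : Fin r,
    X (u k) (v l) = (if l = k then 1 else 0) + (if l = finRotate r k then 1 else 0)

/-- The matrix `½ (Q + Q^π)`. -/
noncomputable def symmetrize {n : ℕ} (Q : Matrix (Fin n) (Fin n) ℝ) : Matrix (Fin n) (Fin n) ℝ :=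
  (1 / 2 : ℝ) • (Q + rot Q)

/-- The first kind: `q_mm = 1` and `Q` is centrosymmetric. -/
def IsTypeA {n : ℕ} (hn : Odd n) (Q : Matrix (Fin n) (Fin n) ℝ) : Prop :=
  Q (centre hn) (centre hn) = 1 ∧ IsCentrosymmetric Q

/-- The second kind, for `A = ½ (Q + Q^π)` and with given witnesses `r`, `P`, `K`, `L`. -/
def IsTypeB {n r : ℕ} (hn : Odd n) (Q : Matrix (Fin n) (Fin n) ℝ) (P : Matrix (Fin r) (Fin r) ℝ)
    (K L : Finset (Fin n)) (hK : K.card = r) (hL : L.card = r) : Prop :=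
  Q (centre hn) (centre hn) = 0 ∧ Odd r ∧
    IsAntiCentrosymmetricPerm P ∧ IsCyclic (P + rot P) ∧
    IsCentroPair hn K L ∧ IsIsolated (symmetrize Q) K L ∧
    sub (symmetrize Q) K L hK hL = symmetrize P ∧
    IsPermutationMatrix (complSub (symmetrize Q) K L hK hL) ∧
    IsCentrosymmetric (complSub (symmetrize Q) K L hK hL)

end Centrosym

/-!
Averaging over the rotation and Birkhoff's theorem give `Ω_n^π` as the convex hull of the matrices
`A = ½ (Q + Q^π)`, so the question is which of these are extreme. Following an edge of `Q` and then
one of `Q^π` permutes the rows, and the cycles of this walk are the components of `Q + Q^π`. If a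
nontrivial cycle differs from its rotated image, exchanging `Q` with `Q^π` on the one or on the
other gives two different points of `Ω_n^π` with midpoint `A`. If every nontrivial cycle is its own
rotated image, then a point of `Ω_n^π` supported where `A` is supported alternates between `t` and
`1 - t` along each cycle and the rotation exchanges the two values, so `t = ½` and the point is `A`.
This holds for all `n`.

For odd `n` the walk is the product of two involutions of the rows, the rotation and its conjugate
by `Q`, and in a cycle that is its own rotated image one of them fixes a row. That row is the
central one or the one that `Q` sends to the central column, and a parity count of the rows and
columns of the cycle of the central row shows that both lie in it. So only this cycle can be its own
rotated image, and it is the submatrix `A[K, L]` of the theorem unless it is trivial.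
-/

namespace Centrosym

open Finset Equiv

section Involutions

variable {α G : Type*}

theorem odd_card_iff_mem_of_involutive {f : α → α} (hf : f.Involutive) {c : α}
    (hc : ∀ x, f x = x ↔ x = c) {K : Finset α} (hK : ∀ x ∈ K, f x ∈ K) :
    Odd #K ↔ c ∈ K := by
  classical
  have heven : Even #(K.erase c) := by
    rw [← ZMod.natCast_eq_zero_iff_even, card_eq_sum_ones, Nat.cast_sum]
    refine sum_involution (fun x _ => f x) (fun _ _ => by decide) (fun x hx _ => ?_)
      (fun x hx => ?_) (fun x _ => hf x)
    · exact fun h => ne_of_mem_erase hx ((hc x).1 h)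
    · refine mem_erase.2 ⟨fun h => ne_of_mem_erase hx ?_, hK x (mem_of_mem_erase hx)⟩
      rw [← hf x, h, (hc c).2 rfl]
  by_cases hcK : c ∈ K
  · simpa only [card_erase_add_one hcK, hcK, iff_true] using heven.add_one
  · rw [erase_eq_of_notMem hcK] at heven
    simpa only [hcK, iff_false, Nat.not_odd_iff_even] using heven

theorem mul_zpow_mul_of_mul_self_eq_one [Group G] {a b : G} (ha : a * a = 1) (hb : b * b = 1)
    (k : ℤ) : a * (a * b) ^ k = (a * b) ^ (-k) * a := by
  have h : SemiconjBy a (a * b) (a * b)⁻¹ := by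
    rw [SemiconjBy, mul_inv_rev, inv_mul_cancel_right, ← mul_assoc, ha, one_mul,
      inv_eq_of_mul_eq_one_left hb]
  simpa only [inv_zpow'] using (h.zpow_right k).eq

variable {a b : Perm α} {x y : α}

theorem sameCycle_mul_apply_apply (ha : a * a = 1) (hb : b * b = 1)
    (h : (a * b).SameCycle x y) : (a * b).SameCycle (a x) (a y) := by
  obtain ⟨k, rfl⟩ := h
  exact ⟨-k, (Perm.congr_fun (mul_zpow_mul_of_mul_self_eq_one ha hb k) x).symm⟩

/- In the dihedral group generated by `a` and `b`, if `(ab)ᵏ x = a x` then the midpoint of the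
segment from `x` to `a x` of the cycle is fixed: by `a` for even `k`, by `b` for odd `k`. -/
theorem exists_fixed_of_sameCycle_mul_apply (ha : a * a = 1) (hb : b * b = 1)
    (h : (a * b).SameCycle x (a x)) : ∃ y, (a * b).SameCycle x y ∧ (a y = y ∨ b y = y) := by
  obtain ⟨k, hk⟩ := h
  have hreflect (j : ℤ) : a (((a * b) ^ j) x) = ((a * b) ^ (k - j)) x := by
    rw [← Perm.mul_apply, mul_zpow_mul_of_mul_self_eq_one ha hb, Perm.mul_apply, ← hk,
      ← Perm.mul_apply, ← zpow_add, neg_add_eq_sub]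
  obtain ⟨j, rfl | rfl⟩ := Int.even_or_odd' k
  · exact ⟨((a * b) ^ j) x, ⟨j, rfl⟩, .inl (by rw [hreflect]; congr 2; ring)⟩
  · refine ⟨((a * b) ^ j) x, ⟨j, rfl⟩, .inr ?_⟩
    calc b (((a * b) ^ j) x) = a (((a * b) ^ (1 + j)) x) := by
          rw [zpow_one_add, Perm.mul_apply, ← Perm.mul_apply a, ← mul_assoc, ha, one_mul]
      _ = ((a * b) ^ j) x := by rw [hreflect]; congr 2; ring

end Involutions

section SameCycle

variable {α β : Type*}

theorem apply_eq_of_sameCycle {f : Perm α} {g : α → β} (hg : ∀ x, g (f x) = g x) {x y : α}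
    (h : f.SameCycle x y) : g x = g y := by
  obtain ⟨k, rfl⟩ := h
  induction k with
  | zero => rfl
  | succ k ih => rw [ih, add_comm, zpow_one_add, Perm.mul_apply, hg]
  | pred k ih =>
    rw [ih, ← hg ((f ^ (-(k : ℤ) - 1)) x), ← Perm.mul_apply, ← zpow_one_add, add_sub_cancel]

theorem sameCycle_of_semiconj [Finite β] {e : α → β} (he : e.Injective) {f : Perm α} {g : Perm β}
    (h : Function.Semiconj e f g) {x y : α} (hxy : g.SameCycle (e x) (e y)) :
    f.SameCycle x y := by
  obtain ⟨k, hk⟩ := hxy.exists_nat_pow_eq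
  refine ⟨k, he ?_⟩
  rw [zpow_natCast, ← Perm.iterate_eq_pow, h.iterate_right k x, Perm.iterate_eq_pow, hk]

end SameCycle

section PermMatrix

variable {ι R : Type*} [DecidableEq ι]

theorem permMatrix_apply [Zero R] [One R] (σ : Perm ι) (i j : ι) :
    σ.permMatrix R i j = if σ i = j then 1 else 0 := by
  simp [Perm.permMatrix, PEquiv.toMatrix_apply, eq_comm]

theorem permMatrix_injective [MulZeroOneClass R] [Nontrivial R] :
    Function.Injective fun σ : Perm ι => σ.permMatrix R := fun σ τ h => by
  ext i
  have hi := congrFun₂ h i (τ i)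
  simpa [permMatrix_apply] using hi

end PermMatrix

section Rotation

variable {n : ℕ} {X : Matrix (Fin n) (Fin n) ℝ}

theorem rot_apply (X : Matrix (Fin n) (Fin n) ℝ) (i j : Fin n) :
    rot X i j = X i.rev j.rev := rfl

theorem symmetrize_apply (X : Matrix (Fin n) (Fin n) ℝ) (i j : Fin n) :
    symmetrize X i j = (X i j + X i.rev j.rev) / 2 := by
  simp only [symmetrize, Matrix.smul_apply, Matrix.add_apply, rot_apply, smul_eq_mul]
  ring

theorem IsCentrosymmetric.apply_rev (hX : IsCentrosymmetric X) (i j : Fin n) :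
    X i.rev j.rev = X i j :=
  congrFun₂ hX i j

theorem IsCentrosymmetric.symmetrize_eq (hX : IsCentrosymmetric X) : symmetrize X = X := by
  ext i j
  rw [symmetrize_apply, hX.apply_rev, add_self_div_two]

theorem isCentrosymmetric_symmetrize (X : Matrix (Fin n) (Fin n) ℝ) :
    IsCentrosymmetric (symmetrize X) := by
  ext i j
  simp [rot_apply, symmetrize_apply, add_comm]

theorem isLinearMap_symmetrize : IsLinearMap ℝ (symmetrize (n := n)) where
  map_add X Y := by
    ext i j
    simp only [symmetrize_apply, Matrix.add_apply]
    ring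
  map_smul c X := by
    ext i j
    simp only [symmetrize_apply, Matrix.smul_apply, smul_eq_mul]
    ring

theorem rot_mem_doublyStochastic (hX : X ∈ doublyStochastic ℝ (Fin n)) :
    rot X ∈ doublyStochastic ℝ (Fin n) :=
  reindex_mem_doublyStochastic (e₁ := Fin.revPerm) (e₂ := Fin.revPerm) hX

theorem symmetrize_mem_Omega (hX : X ∈ doublyStochastic ℝ (Fin n)) : symmetrize X ∈ Omega n := by
  refine ⟨?_, isCentrosymmetric_symmetrize X⟩
  rw [symmetrize, smul_add]
  exact convex_doublyStochastic hX (rot_mem_doublyStochastic hX) (by norm_num) (by norm_num)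
    (by norm_num)

theorem image_symmetrize_doublyStochastic :
    symmetrize '' (doublyStochastic ℝ (Fin n) : Set (Matrix (Fin n) (Fin n) ℝ)) = Omega n := by
  refine Set.Subset.antisymm (Set.image_subset_iff.2 fun X hX => symmetrize_mem_Omega hX) ?_
  exact fun X hX => ⟨X, hX.1, hX.2.symmetrize_eq⟩

theorem Omega_eq_convexHull :
    Omega n = convexHull ℝ (symmetrize '' {σ.permMatrix ℝ | σ : Perm (Fin n)}) := by
  rw [← image_symmetrize_doublyStochastic, doublyStochastic_eq_convexHull_permMatrix,
    isLinearMap_symmetrize.image_convexHull]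

theorem exists_eq_symmetrize_of_mem_extremePoints (hX : X ∈ (Omega n).extremePoints ℝ) :
    ∃ σ : Perm (Fin n), X = symmetrize (σ.permMatrix ℝ) := by
  rw [Omega_eq_convexHull] at hX
  obtain ⟨_, ⟨σ, rfl⟩, rfl⟩ := extremePoints_convexHull_subset hX
  exact ⟨σ, rfl⟩

theorem mem_extremePoints_Omega_of_unique_support (hX : X ∈ Omega n)
    (h : ∀ Y ∈ Omega n, (∀ i j, X i j = 0 → Y i j = 0) → Y = X) :
    X ∈ (Omega n).extremePoints ℝ := by
  refine mem_extremePoints_iff_left.2 ⟨hX, fun Y hY Z hZ hYZ => h Y hY fun i j hij => ?_⟩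
  obtain ⟨a, b, ha, hb, -, rfl⟩ := hYZ
  have haY : 0 ≤ a * Y i j := mul_nonneg ha.le (hY.1.1 i j)
  have hbZ : 0 ≤ b * Z i j := mul_nonneg hb.le (hZ.1.1 i j)
  have haY0 : a * Y i j = 0 := ((add_eq_zero_iff_of_nonneg haY hbZ).1 hij).1
  exact (mul_eq_zero.1 haY0).resolve_left ha.ne'

end Rotation

section Walk

variable {n : ℕ} (σ : Perm (Fin n))

/-- The permutation whose permutation matrix is the rotation of that of `σ`. -/
def rotPerm : Perm (Fin n) := Fin.revPerm * σ * Fin.revPerm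

/-- With `Q` the permutation matrix of `σ`, the permutation of the rows that follows the edge of `Q`
and then the edge of `Q^π`. Its cycles are the sets of rows of the components of the bipartite
multigraph of `Q + Q^π`. -/
def walk : Perm (Fin n) := (rotPerm σ)⁻¹ * σ

theorem rotPerm_apply (i : Fin n) : rotPerm σ i = (σ i.rev).rev := rfl

theorem rot_permMatrix : rot (σ.permMatrix ℝ) = (rotPerm σ).permMatrix ℝ := by
  ext i j
  simp only [rot_apply, permMatrix_apply, rotPerm_apply, Fin.rev_eq_iff]

theorem rotPerm_walk (i : Fin n) : rotPerm σ (walk σ i) = σ i :=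
  (rotPerm σ).apply_symm_apply _

theorem walk_eq_self_iff {i : Fin n} : walk σ i = i ↔ rotPerm σ i = σ i := by
  rw [← rotPerm_walk σ i, (rotPerm σ).injective.eq_iff, eq_comm]

theorem isCentrosymmetric_permMatrix_iff :
    IsCentrosymmetric (σ.permMatrix ℝ) ↔ ∀ i, walk σ i = i := by
  rw [IsCentrosymmetric, rot_permMatrix, permMatrix_injective.eq_iff, Equiv.ext_iff]
  simp only [walk_eq_self_iff]

theorem symmetrize_permMatrix_apply (i j : Fin n) :
    symmetrize (σ.permMatrix ℝ) i j =
      ((if σ i = j then 1 else 0) + (if rotPerm σ i = j then 1 else 0)) / 2 := by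
  rw [symmetrize_apply, ← rot_apply (σ.permMatrix ℝ), rot_permMatrix, permMatrix_apply,
    permMatrix_apply]

theorem symmetrize_permMatrix_ne_zero_iff {i j : Fin n} :
    symmetrize (σ.permMatrix ℝ) i j ≠ 0 ↔ σ i = j ∨ rotPerm σ i = j := by
  rw [symmetrize_permMatrix_apply]
  split_ifs <;> simp_all

theorem revPerm_mul_revPerm : (Fin.revPerm * Fin.revPerm : Perm (Fin n)) = 1 :=
  Equiv.ext Fin.rev_rev

theorem conj_revPerm_mul_self :
    (σ⁻¹ * Fin.revPerm * σ) * (σ⁻¹ * Fin.revPerm * σ) = 1 := by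
  simp only [mul_assoc, mul_inv_cancel_left]
  rw [← mul_assoc Fin.revPerm, revPerm_mul_revPerm, one_mul, inv_mul_cancel]

theorem walk_eq_revPerm_mul_conj : walk σ = Fin.revPerm * (σ⁻¹ * Fin.revPerm * σ) := by
  rw [walk, rotPerm, mul_inv_rev, mul_inv_rev, inv_eq_of_mul_eq_one_left revPerm_mul_revPerm]
  simp only [mul_assoc]

variable {σ}

theorem sameCycle_walk_rev_rev {i j : Fin n} (h : (walk σ).SameCycle i j) :
    (walk σ).SameCycle i.rev j.rev := by
  rw [walk_eq_revPerm_mul_conj] at h ⊢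
  exact sameCycle_mul_apply_apply revPerm_mul_revPerm (conj_revPerm_mul_self σ) h

theorem sameCycle_walk_rev_left_iff {i j : Fin n} :
    (walk σ).SameCycle i.rev j ↔ (walk σ).SameCycle i j.rev :=
  ⟨fun h => by simpa using sameCycle_walk_rev_rev h,
    fun h => by simpa using sameCycle_walk_rev_rev h⟩

theorem sameCycle_walk_of_symmetrize_ne_zero {i i' j : Fin n}
    (h : symmetrize (σ.permMatrix ℝ) i j ≠ 0) (h' : symmetrize (σ.permMatrix ℝ) i' j ≠ 0) :
    (walk σ).SameCycle i i' := by
  have hstep {k l : Fin n} (hkl : σ k = rotPerm σ l) : (walk σ).SameCycle k l := by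
    rw [← rotPerm_walk σ, (rotPerm σ).injective.eq_iff] at hkl
    exact hkl ▸ Perm.sameCycle_apply_right.2 .rfl
  rw [symmetrize_permMatrix_ne_zero_iff] at h h'
  obtain ⟨rfl | rfl, h' | h'⟩ := And.intro h h'
  · exact (σ.injective h').symm.sameCycle _
  · exact hstep h'.symm
  · exact (hstep h').symm
  · exact ((rotPerm σ).injective h').symm.sameCycle _

end Walk

section Extremality

variable {n : ℕ} {σ : Perm (Fin n)} {B : Matrix (Fin n) (Fin n) ℝ}

/-- With `Q` the permutation matrix of `σ`, the permutation obtained from `σ` by choosing the entry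
of `Q^π` instead of that of `Q` in each row of the cycle of `i`. -/
def flipCycle (σ : Perm (Fin n)) (i : Fin n) : Perm (Fin n) := σ * ((walk σ).cycleOf i)⁻¹

theorem flipCycle_apply (i j : Fin n) :
    flipCycle σ i j = if (walk σ).SameCycle i j then rotPerm σ j else σ j := by
  have hwalk : σ ((walk σ)⁻¹ j) = rotPerm σ j := by
    rw [← rotPerm_walk]
    exact congrArg _ ((walk σ).apply_symm_apply j)
  rw [flipCycle, Perm.mul_apply, Perm.cycleOf_inv, Perm.cycleOf_apply, apply_ite σ, hwalk]
  simp only [Perm.sameCycle_inv]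

theorem rotPerm_flipCycle_apply (i j : Fin n) :
    rotPerm (flipCycle σ i) j = if (walk σ).SameCycle i j.rev then σ j else rotPerm σ j := by
  rw [rotPerm_apply, flipCycle_apply, apply_ite Fin.rev, rotPerm_apply, Fin.rev_rev, Fin.rev_rev,
    rotPerm_apply]

theorem symmetrize_flipCycle_add_symmetrize_flipCycle_rev (i : Fin n) :
    symmetrize ((flipCycle σ i).permMatrix ℝ) + symmetrize ((flipCycle σ i.rev).permMatrix ℝ) =
      (2 : ℝ) • symmetrize (σ.permMatrix ℝ) := by
  ext k l
  simp only [Matrix.add_apply, Matrix.smul_apply, smul_eq_mul, symmetrize_permMatrix_apply,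
    flipCycle_apply, rotPerm_flipCycle_apply, sameCycle_walk_rev_left_iff, Fin.rev_rev]
  by_cases hk : (walk σ).SameCycle i k <;> by_cases hk' : (walk σ).SameCycle i k.rev <;>
    simp only [hk, hk', if_true, if_false] <;> ring

theorem sameCycle_rev_or_walk_eq_self_of_mem_extremePoints
    (h : symmetrize (σ.permMatrix ℝ) ∈ (Omega n).extremePoints ℝ) (i : Fin n) :
    (walk σ).SameCycle i i.rev ∨ walk σ i = i := by
  by_contra! ⟨hcycle, hfix⟩
  rw [Ne, walk_eq_self_iff] at hfix
  have hflip : symmetrize ((flipCycle σ i).permMatrix ℝ) = symmetrize (σ.permMatrix ℝ) := by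
    refine (mem_extremePoints_iff_left.1 h).2 _
      (symmetrize_mem_Omega permMatrix_mem_doublyStochastic)
      (symmetrize ((flipCycle σ i.rev).permMatrix ℝ))
      (symmetrize_mem_Omega permMatrix_mem_doublyStochastic)
      ⟨1 / 2, 1 / 2, by norm_num, by norm_num, by norm_num, ?_⟩
    rw [← smul_add, symmetrize_flipCycle_add_symmetrize_flipCycle_rev, smul_smul]
    norm_num
  have hentry := congrFun₂ hflip i (σ i)
  simp [symmetrize_permMatrix_apply, flipCycle_apply, rotPerm_flipCycle_apply, hcycle, hfix,
    Perm.SameCycle.refl] at hentry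

theorem apply_eq_zero_of_support (hB : ∀ i j, symmetrize (σ.permMatrix ℝ) i j = 0 → B i j = 0)
    {i j : Fin n} (h : σ i ≠ j) (h' : rotPerm σ i ≠ j) : B i j = 0 :=
  hB i j (not_not.1 fun hne => ((symmetrize_permMatrix_ne_zero_iff σ).1 hne).elim h h')

section Support

variable (hB : B ∈ doublyStochastic ℝ (Fin n))
  (hsupp : ∀ i j, symmetrize (σ.permMatrix ℝ) i j = 0 → B i j = 0)
include hB hsupp

theorem apply_eq_one_of_walk_eq_self {i : Fin n} (hi : walk σ i = i) : B i (σ i) = 1 := by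
  rw [← sum_row_of_mem_doublyStochastic hB i, Fintype.sum_eq_single (σ i)]
  intro j hj
  exact apply_eq_zero_of_support hsupp hj.symm ((walk_eq_self_iff σ).1 hi ▸ hj.symm)

theorem apply_add_apply_rotPerm {i : Fin n} (hi : walk σ i ≠ i) :
    B i (σ i) + B i (rotPerm σ i) = 1 := by
  rw [← sum_row_of_mem_doublyStochastic hB i,
    Fintype.sum_eq_add (σ i) (rotPerm σ i) fun h => hi ((walk_eq_self_iff σ).2 h.symm)]
  exact fun j hj => apply_eq_zero_of_support hsupp hj.1.symm hj.2.symm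

theorem apply_add_apply_walk {i : Fin n} (hi : walk σ i ≠ i) :
    B i (σ i) + B (walk σ i) (σ i) = 1 := by
  rw [← sum_col_of_mem_doublyStochastic hB (σ i), Fintype.sum_eq_add i (walk σ i) hi.symm]
  refine fun k hk => apply_eq_zero_of_support hsupp (σ.injective.ne hk.1) ?_
  rw [← rotPerm_walk σ]
  exact (rotPerm σ).injective.ne hk.2

theorem apply_walk_eq_apply (i : Fin n) : B (walk σ i) (σ (walk σ i)) = B i (σ i) := by
  by_cases hi : walk σ i = i
  · rw [hi]
  · have hrow := apply_add_apply_rotPerm hB hsupp ((walk σ).injective.ne hi)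
    rw [rotPerm_walk] at hrow
    linarith [apply_add_apply_walk hB hsupp hi]

end Support

theorem apply_eq_half_of_sameCycle_rev (hB : B ∈ Omega n)
    (hsupp : ∀ i j, symmetrize (σ.permMatrix ℝ) i j = 0 → B i j = 0) {i : Fin n}
    (hi : walk σ i ≠ i) (hcycle : (walk σ).SameCycle i i.rev) :
    B i (σ i) = 1 / 2 ∧ B i (rotPerm σ i) = 1 / 2 := by
  have hsum := apply_add_apply_rotPerm hB.1 hsupp hi
  have hconst : B i (σ i) = B i.rev (σ i.rev) :=
    apply_eq_of_sameCycle (g := fun i => B i (σ i)) (apply_walk_eq_apply hB.1 hsupp) hcycle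
  have hcentro : B i.rev (σ i.rev) = B i (rotPerm σ i) := by
    rw [← hB.2.apply_rev, Fin.rev_rev, rotPerm_apply]
  constructor <;> linarith

theorem symmetrize_mem_extremePoints_of_sameCycle_rev
    (h : ∀ i, (walk σ).SameCycle i i.rev ∨ walk σ i = i) :
    symmetrize (σ.permMatrix ℝ) ∈ (Omega n).extremePoints ℝ := by
  refine mem_extremePoints_Omega_of_unique_support
    (symmetrize_mem_Omega permMatrix_mem_doublyStochastic) fun B hB hsupp => ?_
  ext i j
  rw [symmetrize_permMatrix_apply]
  by_cases hi : walk σ i = i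
  · rw [(walk_eq_self_iff σ).1 hi]
    split_ifs with hj
    · rw [← hj, apply_eq_one_of_walk_eq_self hB.1 hsupp hi, add_self_div_two]
    · rw [apply_eq_zero_of_support hsupp hj ((walk_eq_self_iff σ).1 hi ▸ hj), add_self_div_two]
  · obtain ⟨hσ, hrot⟩ := apply_eq_half_of_sameCycle_rev hB hsupp hi ((h i).resolve_right hi)
    rw [walk_eq_self_iff] at hi
    split_ifs with hj hj' hj'
    · exact absurd (hj'.trans hj.symm) hi
    · rw [← hj, hσ, add_zero]
    · rw [← hj', hrot, zero_add]
    · rw [apply_eq_zero_of_support hsupp hj hj', add_zero, zero_div]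

theorem symmetrize_permMatrix_mem_extremePoints_iff :
    symmetrize (σ.permMatrix ℝ) ∈ (Omega n).extremePoints ℝ ↔
      ∀ i, (walk σ).SameCycle i i.rev ∨ walk σ i = i :=
  ⟨sameCycle_rev_or_walk_eq_self_of_mem_extremePoints,
    symmetrize_mem_extremePoints_of_sameCycle_rev⟩

end Extremality

section Submatrix

variable {n r : ℕ} {K L : Finset (Fin n)}

theorem image_rev_eq_self_iff : K.image Fin.rev = K ↔ ∀ i, i.rev ∈ K ↔ i ∈ K := by
  have himage (i : Fin n) : i ∈ K.image Fin.rev ↔ i.rev ∈ K := by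
    simp only [mem_image, Fin.rev_eq_iff, exists_eq_right]
  simp only [Finset.ext_iff, himage]

theorem image_rev_compl (hK : K.image Fin.rev = K) : Kᶜ.image Fin.rev = Kᶜ :=
  image_rev_eq_self_iff.2 fun i => by
    rw [mem_compl, mem_compl, image_rev_eq_self_iff.1 hK]

theorem orderEmbOfFin_rev (hK : K.image Fin.rev = K) (hc : #K = r) (a : Fin r) :
    K.orderEmbOfFin hc a.rev = (K.orderEmbOfFin hc a).rev := by
  have h : (fun a : Fin r => (K.orderEmbOfFin hc a.rev).rev) = K.orderEmbOfFin hc := by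
    refine orderEmbOfFin_unique hc (fun a => ?_) fun a b hab => ?_
    · exact (image_rev_eq_self_iff.1 hK _).2 (orderEmbOfFin_mem _ _ _)
    · simpa using hab
  rw [← congrFun h a, Fin.rev_rev]

theorem exists_orderEmbOfFin_eq (hc : #K = r) {i : Fin n} (hi : i ∈ K) :
    ∃ a, K.orderEmbOfFin hc a = i := by
  rwa [← Set.mem_range, range_orderEmbOfFin, mem_coe]

theorem symmetrize_sub (X : Matrix (Fin n) (Fin n) ℝ) (hK : #K = r) (hL : #L = r)
    (hKr : K.image Fin.rev = K) (hLr : L.image Fin.rev = L) :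
    sub (symmetrize X) K L hK hL = symmetrize (sub X K L hK hL) := by
  ext a b
  simp [sub, symmetrize_apply, orderEmbOfFin_rev hKr, orderEmbOfFin_rev hLr]

variable {σ : Perm (Fin n)}

theorem complSub_symmetrize_permMatrix (hK : #K = r) (hL : #L = r)
    (hfix : ∀ i ∉ K, walk σ i = i) :
    complSub (symmetrize (σ.permMatrix ℝ)) K L hK hL = complSub (σ.permMatrix ℝ) K L hK hL := by
  ext a b
  have ha := mem_compl.1 (orderEmbOfFin_mem Kᶜ (card_compl_eq hK) a)
  simp only [complSub, sub, Matrix.submatrix_apply, symmetrize_permMatrix_apply,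
    permMatrix_apply, (walk_eq_self_iff σ).1 (hfix _ ha), add_self_div_two]

theorem isIsolated_symmetrize_permMatrix (hσ : ∀ i, σ i ∈ L ↔ i ∈ K)
    (hrot : ∀ i, rotPerm σ i ∈ L ↔ i ∈ K) : IsIsolated (symmetrize (σ.permMatrix ℝ)) K L := by
  have hmem {i j : Fin n} (h : symmetrize (σ.permMatrix ℝ) i j ≠ 0) : j ∈ L ↔ i ∈ K := by
    obtain rfl | rfl := (symmetrize_permMatrix_ne_zero_iff σ).1 h
    exacts [hσ i, hrot i]
  exact ⟨fun i hi j hj => not_not.1 fun h => hj ((hmem h).2 hi),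
    fun i hi j hj => not_not.1 fun h => hi ((hmem h).1 hj)⟩

theorem exists_perm_orderEmbOfFin (hK : #K = r) (hL : #L = r) (h : ∀ i ∈ K, σ i ∈ L) :
    ∃ s : Perm (Fin r), ∀ a, L.orderEmbOfFin hL (s a) = σ (K.orderEmbOfFin hK a) := by
  choose s hs using fun a => exists_orderEmbOfFin_eq hL (h _ (orderEmbOfFin_mem K hK a))
  have hinj : Function.Injective s := fun a b hab =>
    (K.orderEmbOfFin hK).injective (σ.injective (by rw [← hs a, ← hs b, hab]))
  exact ⟨Equiv.ofBijective s (Finite.injective_iff_bijective.1 hinj), hs⟩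

variable {s : Perm (Fin r)} {hK : #K = r} {hL : #L = r}
  (hs : ∀ a, L.orderEmbOfFin hL (s a) = σ (K.orderEmbOfFin hK a))
include hs

theorem sub_permMatrix_eq : sub (σ.permMatrix ℝ) K L hK hL = s.permMatrix ℝ := by
  ext a b
  simp only [sub, Matrix.submatrix_apply, permMatrix_apply, ← hs,
    (L.orderEmbOfFin hL).injective.eq_iff]

theorem semiconj_orderEmbOfFin_walk (hKr : K.image Fin.rev = K) (hLr : L.image Fin.rev = L) :
    Function.Semiconj (K.orderEmbOfFin hK) (walk s) (walk σ) := by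
  have hrot (a : Fin r) :
      L.orderEmbOfFin hL (rotPerm s a) = rotPerm σ (K.orderEmbOfFin hK a) := by
    rw [rotPerm_apply, orderEmbOfFin_rev hLr, hs, orderEmbOfFin_rev hKr, rotPerm_apply]
  intro a
  apply (rotPerm σ).injective
  rw [← hrot, rotPerm_walk, rotPerm_walk, hs]

end Submatrix

section Cyclic

variable {r : ℕ} {s : Perm (Fin r)}

theorem isAntiCentrosymmetricPerm_permMatrix (hs : ∀ a, walk s a ≠ a) :
    IsAntiCentrosymmetricPerm (s.permMatrix ℝ) := by
  refine ⟨⟨s, rfl⟩, fun a b hab => ?_⟩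
  obtain rfl : s a = b := by simpa [permMatrix_apply] using hab
  rw [← rot_apply (s.permMatrix ℝ), rot_permMatrix, permMatrix_apply,
    if_neg (mt (walk_eq_self_iff s).2 (hs a))]

theorem isCyclic_permMatrix_add_rot (hs : (walk s).IsCycle) (hsupp : (walk s).support = univ) :
    IsCyclic (s.permMatrix ℝ + rot (s.permMatrix ℝ)) := by
  have hcard : #(walk s).support = r := by rw [hsupp, card_univ, Fintype.card_fin]
  have hconj : IsConj (finRotate r) (walk s) := by
    rw [Perm.isConj_iff_cycleType_eq, hs.cycleType, hcard,
      cycleType_finRotate_of_le (hcard ▸ hs.two_le_card_support)]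
  obtain ⟨u, hu⟩ := isConj_iff.1 hconj
  have hwalk (k : Fin r) : walk s (u k) = u (finRotate r k) := by simp [← hu]
  refine ⟨u, u.trans (rotPerm s), fun k l => ?_⟩
  rw [Matrix.add_apply, rot_permMatrix, permMatrix_apply, permMatrix_apply, ← rotPerm_walk, hwalk,
    add_comm]
  simp only [trans_apply, (rotPerm s).injective.eq_iff, u.injective.eq_iff, eq_comm]

theorem IsCyclic.forall_rel {X : Matrix (Fin r) (Fin r) ℝ} (hX : IsCyclic X)
    {R : Fin r → Fin r → Prop} (hR : Equivalence R)
    (h : ∀ a a' b, X a b ≠ 0 → X a' b ≠ 0 → R a a') (a a' : Fin r) : R a a' := by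
  obtain ⟨u, v, huv⟩ := hX
  have hstep (k : Fin r) : R (u k) (u (finRotate r k)) := by
    refine h _ _ (v (finRotate r k)) ?_ ?_ <;> rw [huv, if_pos rfl] <;> positivity
  obtain _ | m := r
  · exact a.elim0
  have hzero (k : Fin (m + 1)) : R (u 0) (u k) := by
    induction k using Fin.induction with
    | zero => exact hR.refl _
    | succ k ih =>
      rw [← Fin.coeSucc_eq_succ, ← finRotate_apply]
      exact hR.trans ih (hstep _)
  simpa using hR.trans (hR.symm (hzero (u.symm a))) (hzero (u.symm a'))

end Cyclic

section Central

variable {n : ℕ} {σ : Perm (Fin n)} {hn : Odd n} {i : Fin n}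

theorem rev_eq_self_iff (hn : Odd n) : i.rev = i ↔ i = centre hn := by
  obtain ⟨m, rfl⟩ := hn
  simp only [Fin.ext_iff, Fin.val_rev, centre]
  omega

theorem rev_centre (hn : Odd n) : (centre hn).rev = centre hn :=
  (rev_eq_self_iff hn).2 rfl

theorem odd_card_iff_centre_mem {K : Finset (Fin n)} (hK : K.image Fin.rev = K) :
    Odd #K ↔ centre hn ∈ K :=
  odd_card_iff_mem_of_involutive Fin.rev_involutive (fun _ => rev_eq_self_iff hn)
    fun i => (image_rev_eq_self_iff.1 hK i).2

theorem walk_centre_eq_self_iff : walk σ (centre hn) = centre hn ↔ σ (centre hn) = centre hn := by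
  rw [walk_eq_self_iff, rotPerm_apply, rev_centre, rev_eq_self_iff hn]

/-- The rows of the component of the bipartite multigraph of `Q + Q^π` that contains the central
row, for the permutation matrix `Q` of `σ`. -/
def centralRows (σ : Perm (Fin n)) (hn : Odd n) : Finset (Fin n) :=
  {i | (walk σ).SameCycle (centre hn) i}

/-- The columns of the component of the bipartite multigraph of `Q + Q^π` that contains the central
row, for the permutation matrix `Q` of `σ`. -/
def centralCols (σ : Perm (Fin n)) (hn : Odd n) : Finset (Fin n) :=
  (centralRows σ hn).map σ.toEmbedding

theorem mem_centralRows : i ∈ centralRows σ hn ↔ (walk σ).SameCycle (centre hn) i := by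
  simp [centralRows]

theorem apply_mem_centralCols : σ i ∈ centralCols σ hn ↔ i ∈ centralRows σ hn := by
  simp [centralCols]

theorem rotPerm_apply_mem_centralCols :
    rotPerm σ i ∈ centralCols σ hn ↔ i ∈ centralRows σ hn := by
  obtain ⟨j, rfl⟩ := (walk σ).surjective i
  rw [rotPerm_walk, apply_mem_centralCols, mem_centralRows, mem_centralRows,
    Perm.sameCycle_apply_right]

variable (σ hn)

theorem card_centralCols : #(centralCols σ hn) = #(centralRows σ hn) :=
  card_map _

theorem image_rev_centralRows : (centralRows σ hn).image Fin.rev = centralRows σ hn :=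
  image_rev_eq_self_iff.2 fun i => by
    rw [mem_centralRows, mem_centralRows, ← sameCycle_walk_rev_left_iff, rev_centre]

theorem image_rev_centralCols : (centralCols σ hn).image Fin.rev = centralCols σ hn := by
  refine image_rev_eq_self_iff.2 fun j => ?_
  obtain ⟨i, rfl⟩ := σ.surjective j
  rw [← Fin.rev_rev i, ← rotPerm_apply, rotPerm_apply_mem_centralCols, Fin.rev_rev,
    apply_mem_centralCols, image_rev_eq_self_iff.1 (image_rev_centralRows σ hn)]

theorem centre_mem_centralRows : centre hn ∈ centralRows σ hn :=
  mem_centralRows.2 .rfl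

theorem odd_card_centralRows : Odd #(centralRows σ hn) :=
  (odd_card_iff_centre_mem (image_rev_centralRows σ hn)).2 (centre_mem_centralRows σ hn)

theorem centre_mem_centralCols : centre hn ∈ centralCols σ hn := by
  rw [← odd_card_iff_centre_mem (image_rev_centralCols σ hn), card_centralCols]
  exact odd_card_centralRows σ hn

theorem isCentroPair_centralRows_centralCols :
    IsCentroPair hn (centralRows σ hn) (centralCols σ hn) :=
  ⟨centre_mem_centralRows σ hn, centre_mem_centralCols σ hn, image_rev_centralRows σ hn,
    image_rev_centralCols σ hn⟩

variable {σ hn}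

theorem sameCycle_rev_iff_mem_centralRows :
    (walk σ).SameCycle i i.rev ↔ i ∈ centralRows σ hn := by
  refine ⟨fun h => ?_, fun h => ?_⟩
  · rw [walk_eq_revPerm_mul_conj] at h
    obtain ⟨y, hiy, hy⟩ :=
      exists_fixed_of_sameCycle_mul_apply revPerm_mul_revPerm (conj_revPerm_mul_self σ) h
    rw [← walk_eq_revPerm_mul_conj] at hiy
    suffices h : y ∈ centralRows σ hn from
      mem_centralRows.2 ((mem_centralRows.1 h).trans hiy.symm)
    obtain hy | hy := hy
    · rw [(rev_eq_self_iff hn).1 hy]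
      exact centre_mem_centralRows σ hn
    · have hσy : (σ y).rev = σ y := Perm.inv_eq_iff_eq.1 hy
      rw [← apply_mem_centralCols, (rev_eq_self_iff hn).1 hσy]
      exact centre_mem_centralCols σ hn
  · have hrev := (image_rev_eq_self_iff.1 (image_rev_centralRows σ hn) i).2 h
    exact (mem_centralRows.1 h).symm.trans (mem_centralRows.1 hrev)

end Central

section Classification

variable {n r : ℕ} {σ : Perm (Fin n)} {hn : Odd n}

theorem isTypeA_permMatrix_iff :
    IsTypeA hn (σ.permMatrix ℝ) ↔ ∀ i, walk σ i = i := by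
  refine ⟨fun h => (isCentrosymmetric_permMatrix_iff σ).1 h.2,
    fun h => ⟨?_, (isCentrosymmetric_permMatrix_iff σ).2 h⟩⟩
  rw [permMatrix_apply, if_pos (walk_centre_eq_self_iff.1 (h _))]

section IsTypeB

variable {P : Matrix (Fin r) (Fin r) ℝ} {K L : Finset (Fin n)} {hK : #K = r} {hL : #L = r}
  {i : Fin n}

theorem IsTypeB.sameCycle_centre (h : IsTypeB hn (σ.permMatrix ℝ) P K L hK hL) (hi : i ∈ K) :
    (walk σ).SameCycle (centre hn) i := by
  obtain ⟨-, -, -, hcyclic, ⟨hcK, -⟩, -, hsub, -⟩ := h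
  have hne {a b : Fin r} (hab : (P + rot P) a b ≠ 0) :
      symmetrize (σ.permMatrix ℝ) (K.orderEmbOfFin hK a) (L.orderEmbOfFin hL b) ≠ 0 := by
    have hentry := congrFun₂ hsub a b
    rw [sub, Matrix.submatrix_apply] at hentry
    rw [hentry, symmetrize_apply]
    exact div_ne_zero hab two_ne_zero
  obtain ⟨a, ha⟩ := exists_orderEmbOfFin_eq hK hcK
  obtain ⟨b, rfl⟩ := exists_orderEmbOfFin_eq hK hi
  rw [← ha]
  exact hcyclic.forall_rel ((Perm.SameCycle.equivalence (walk σ)).comap (K.orderEmbOfFin hK))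
    (fun _ _ _ h h' => sameCycle_walk_of_symmetrize_ne_zero (hne h) (hne h')) a b

theorem IsTypeB.walk_eq_self (h : IsTypeB hn (σ.permMatrix ℝ) P K L hK hL) (hi : i ∉ K) :
    walk σ i = i := by
  obtain ⟨-, -, -, -, -, ⟨-, hiso⟩, -, ⟨t, ht⟩, -⟩ := h
  have hσi : σ i ∉ L := fun hmem =>
    (symmetrize_permMatrix_ne_zero_iff σ).2 (.inl rfl) (hiso i hi (σ i) hmem)
  obtain ⟨a, ha⟩ := exists_orderEmbOfFin_eq (card_compl_eq hK) (mem_compl.2 hi)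
  obtain ⟨b, hb⟩ := exists_orderEmbOfFin_eq (card_compl_eq hL) (mem_compl.2 hσi)
  have hentry := congrFun₂ ht a b
  rw [complSub, sub, Matrix.submatrix_apply, ha, hb, symmetrize_permMatrix_apply, if_pos rfl,
    permMatrix_apply] at hentry
  rw [walk_eq_self_iff]
  by_contra hne
  rw [if_neg hne] at hentry
  split_ifs at hentry <;> norm_num at hentry

theorem IsTypeB.complSub_eq_rot (h : IsTypeB hn (σ.permMatrix ℝ) P K L hK hL) :
    complSub (σ.permMatrix ℝ) K L hK hL = rot (complSub (σ.permMatrix ℝ) K L hK hL) := by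
  rw [← complSub_symmetrize_permMatrix hK hL fun i => h.walk_eq_self]
  obtain ⟨-, -, -, -, -, -, -, -, hcentro⟩ := h
  exact hcentro.symm

end IsTypeB

section InducedPerm

variable {s : Perm (Fin #(centralRows σ hn))}
  (hs : ∀ a, (centralCols σ hn).orderEmbOfFin (card_centralCols σ hn) (s a) =
    σ ((centralRows σ hn).orderEmbOfFin rfl a))
include hs

theorem sameCycle_walk_of_induced (a b : Fin #(centralRows σ hn)) :
    (walk s).SameCycle a b := by
  refine sameCycle_of_semiconj ((centralRows σ hn).orderEmbOfFin rfl).injective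
    (semiconj_orderEmbOfFin_walk hs (image_rev_centralRows σ hn) (image_rev_centralCols σ hn)) ?_
  exact (mem_centralRows.1 (orderEmbOfFin_mem _ rfl a)).symm.trans
    (mem_centralRows.1 (orderEmbOfFin_mem _ rfl b))

theorem walk_ne_self_of_induced (hc : σ (centre hn) ≠ centre hn) (a : Fin #(centralRows σ hn)) :
    walk s a ≠ a := fun ha => by
  have hfix := semiconj_orderEmbOfFin_walk hs (image_rev_centralRows σ hn)
    (image_rev_centralCols σ hn) a
  rw [ha] at hfix
  have hcycle := mem_centralRows.1 (orderEmbOfFin_mem (centralRows σ hn) rfl a)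
  exact hc (walk_centre_eq_self_iff.1 (hcycle.apply_eq_self_iff.2 hfix.symm))

theorem isCycle_walk_of_induced (hc : σ (centre hn) ≠ centre hn) : (walk s).IsCycle := by
  obtain ⟨a, -⟩ := exists_orderEmbOfFin_eq rfl (centre_mem_centralRows σ hn)
  exact ⟨a, walk_ne_self_of_induced hs hc a, fun b _ => sameCycle_walk_of_induced hs a b⟩

end InducedPerm

theorem isPermutationMatrix_complSub_centralRows :
    IsPermutationMatrix (complSub (σ.permMatrix ℝ) (centralRows σ hn) (centralCols σ hn) rfl
      (card_centralCols σ hn)) := by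
  obtain ⟨t, ht⟩ := exists_perm_orderEmbOfFin (σ := σ)
    (card_compl_eq (K := centralRows σ hn) rfl) (card_compl_eq (card_centralCols σ hn))
    fun i hi => by rwa [mem_compl, apply_mem_centralCols, ← mem_compl]
  exact ⟨t, sub_permMatrix_eq ht⟩

theorem isTypeB_centralRows_centralCols (hc : σ (centre hn) ≠ centre hn)
    (hfix : ∀ i ∉ centralRows σ hn, walk σ i = i) :
    IsTypeB hn (σ.permMatrix ℝ)
      (sub (σ.permMatrix ℝ) (centralRows σ hn) (centralCols σ hn) rfl (card_centralCols σ hn))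
      (centralRows σ hn) (centralCols σ hn) rfl (card_centralCols σ hn) := by
  have hK := image_rev_centralRows σ hn
  have hL := image_rev_centralCols σ hn
  obtain ⟨s, hs⟩ := exists_perm_orderEmbOfFin (σ := σ) (K := centralRows σ hn) rfl
    (card_centralCols σ hn) fun i => apply_mem_centralCols.2
  have hne := walk_ne_self_of_induced hs hc
  have hsupp : (walk s).support = univ := by simpa [Finset.ext_iff] using hne
  refine ⟨by rw [permMatrix_apply, if_neg hc], odd_card_centralRows σ hn, ?_, ?_,
    isCentroPair_centralRows_centralCols σ hn,
    isIsolated_symmetrize_permMatrix (fun _ => apply_mem_centralCols)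
      fun _ => rotPerm_apply_mem_centralCols,
    symmetrize_sub _ _ _ hK hL, ?_, ?_⟩
  · rw [sub_permMatrix_eq hs]
    exact isAntiCentrosymmetricPerm_permMatrix hne
  · rw [sub_permMatrix_eq hs]
    exact isCyclic_permMatrix_add_rot (isCycle_walk_of_induced hs hc) hsupp
  · rw [complSub_symmetrize_permMatrix _ _ hfix]
    exact isPermutationMatrix_complSub_centralRows
  · rw [complSub, symmetrize_sub _ _ _ (image_rev_compl hK) (image_rev_compl hL)]
    exact isCentrosymmetric_symmetrize _

theorem isTypeA_or_exists_isTypeB_iff :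
    (IsTypeA hn (σ.permMatrix ℝ) ∨ ∃ (r : ℕ) (P : Matrix (Fin r) (Fin r) ℝ) (K L : Finset (Fin n))
        (hK : #K = r) (hL : #L = r), IsTypeB hn (σ.permMatrix ℝ) P K L hK hL) ↔
      ∀ i, (walk σ).SameCycle i i.rev ∨ walk σ i = i := by
  refine ⟨?_, fun h => ?_⟩
  · rintro (hA | ⟨r, P, K, L, hK, hL, hB⟩) i
    · exact .inr (isTypeA_permMatrix_iff.1 hA i)
    · refine (em (i ∈ K)).imp (fun hi => ?_) hB.walk_eq_self
      exact sameCycle_rev_iff_mem_centralRows.2 (mem_centralRows.2 (hB.sameCycle_centre hi))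
  · have hfix : ∀ i ∉ centralRows σ hn, walk σ i = i := fun i hi =>
      (h i).resolve_left (mt sameCycle_rev_iff_mem_centralRows.1 hi)
    by_cases hc : σ (centre hn) = centre hn
    · refine .inl (isTypeA_permMatrix_iff.2 fun i => ?_)
      by_cases hi : i ∈ centralRows σ hn
      · exact (mem_centralRows.1 hi).apply_eq_self_iff.1 (walk_centre_eq_self_iff.2 hc)
      · exact hfix i hi
    · exact .inr ⟨_, _, _, _, _, _, isTypeB_centralRows_centralCols hc hfix⟩

end Classification

end Centrosym

theorem mainTheorem3 (n : ℕ) (hn : Odd n) (h3 : 3 ≤ n) :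
    (Centrosym.Omega n).extremePoints ℝ =
      {A : Matrix (Fin n) (Fin n) ℝ | ∃ Q : Matrix (Fin n) (Fin n) ℝ,
        Centrosym.IsPermutationMatrix Q ∧ A = Centrosym.symmetrize Q ∧
        (Centrosym.IsTypeA hn Q ∨
          ∃ (r : ℕ) (P : Matrix (Fin r) (Fin r) ℝ) (K L : Finset (Fin n))
            (hK : K.card = r) (hL : L.card = r), Centrosym.IsTypeB hn Q P K L hK hL)} ∧
    ∀ Q : Matrix (Fin n) (Fin n) ℝ, Centrosym.IsPermutationMatrix Q →
      (Centrosym.IsTypeA hn Q →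
        Q = Centrosym.rot Q ∧ Centrosym.IsPermutationMatrix (Centrosym.symmetrize Q) ∧
          Centrosym.IsCentrosymmetric (Centrosym.symmetrize Q)) ∧
      (∀ (r : ℕ) (P : Matrix (Fin r) (Fin r) ℝ) (K L : Finset (Fin n))
        (hK : K.card = r) (hL : L.card = r), Centrosym.IsTypeB hn Q P K L hK hL →
          Centrosym.complSub Q K L hK hL =
            Centrosym.rot (Centrosym.complSub Q K L hK hL)) := by
  refine ⟨Set.Subset.antisymm (fun A hA => ?_) ?_, ?_⟩
  · obtain ⟨σ, rfl⟩ := Centrosym.exists_eq_symmetrize_of_mem_extremePoints hA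
    exact ⟨_, ⟨σ, rfl⟩, rfl, Centrosym.isTypeA_or_exists_isTypeB_iff.2
      (Centrosym.symmetrize_permMatrix_mem_extremePoints_iff.1 hA)⟩
  · rintro _ ⟨_, ⟨σ, rfl⟩, rfl, h⟩
    exact Centrosym.symmetrize_permMatrix_mem_extremePoints_iff.2
      (Centrosym.isTypeA_or_exists_isTypeB_iff.1 h)
  · rintro _ ⟨σ, rfl⟩
    refine ⟨fun hA => ?_, fun r P K L hK hL hB => hB.complSub_eq_rot⟩
    rw [hA.2.symmetrize_eq]
    exact ⟨hA.2.symm, ⟨σ, rfl⟩, hA.2⟩
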